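/- Let $F$ be a field of characteristic $0$ and let $E$ be the Grassmann algebra of an $F$-vector space $L$ with basis $e_1,e_2,\dots$. A map $\deg$ from $\{e_1,e_2,\dots\}$ to an abelian group $G$ defines a $G$-grading $E=\bigoplus_{g\in G}E_g$ in which $E_g$ is spanned by the monomials $e_{i_1}\cdots e_{i_s}$ with $\deg e_{i_1}+\cdots+\deg e_{i_s}=g$. For positive integers $a,b,k$ let $E_{(-b,0,a)}^{(\infty,k,\infty)}$ be $E$ with a $\mathbb Z$-grading of this kind in which every $e_i$ has degree $-b$, $0$ or $a$, infinitely many $e_i$ have degree $-b$, exactly $k$ have degree $0$, and infinitely many have degree $a$. Let $E_k$ be $E$ with the $\mathbb Z_2$-grading in which $e_1,\dots,e_k$ have degree $0$ and all other $e_i$ have degree $1$, and let $E_\infty$ be $E$ with the $\mathbb Z_2$-grading in which $e_i$ has degree $0$ for even $i$ and degree $1$ for odd $i$. For a group $G$ let $F\langle X|G\rangle$ be the free associative algebra on variables $x_i^{g}$ $(g\in G,\ i\in\mathbb N)$, where $x_i^g$ has degree $g$. For a $G$-graded algebra $A=\bigoplus_{g\in G} A_g$, let $T_G(A)$ be the set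 of its graded identities: the polynomials in $F\langle X|G\rangle$ that vanish whenever each variable of degree $g$ is replaced by an element of $A_g$. The variety defined by a set $S\subseteq F\langle X|G\rangle$ is the class of all $G$-graded algebras $A$ with $S\subseteq T_G(A)$; a member $A$ generates the variety if $T_G(A)$ is equal to the set of the polynomials that are graded identities of all algebras of the variety. Let $\pi_2\colon F\langle X|\mathbb Z\rangle\to F\langle X|\mathbb Z_2\rangle$ be any homomorphism of unital algebras that sends each variable of degree $g$ to a variable of degree $g \bmod 2$ and sends distinct variables to distinct variables. **Theorem.** Let $a,b,k$ be positive integers with $\gcd(a,b)=1$. Then: 1. $E_{(-b,0,a)}^{(\infty,k,\infty)}$ has full support, i.e. for every $g\in\mathbb Z$ its component of degree $g$ is nonzero. 2. If $ab$ is odd, then $E_{(-b,0,a)}^{(\infty,k,\infty)}$ generates the variety of $\mathbb Z$-graded algebras defined by $J=\{f\in F\langle X|\mathbb Z\rangle : \pi_2(f)\in T_{\mathbb Z_2}(E_k)\}$, and $T_{\mathbb Z}\bigl(E_{(-b,0,a)}^{(\infty,k,\infty)}\bigr)=J$. 3. If $ab$ is even, then $E_{(-b,0,a)}^{(\infty,k,\infty)}$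 generates the variety of $\mathbb Z$-graded algebras defined by $J=\{f\in F\langle X|\mathbb Z\rangle : \pi_2(f)\in T_{\mathbb Z_2}(E_\infty)\}$, and $T_{\mathbb Z}\bigl(E_{(-b,0,a)}^{(\infty,k,\infty)}\bigr)=J$. -/

import Mathlib

universe u

open scoped DirectSum

noncomputable section

namespace GrassmannGraded

/-! ## Graded algebras, free graded algebras, graded identities, varieties -/

section Graded

variable {F : Type u} [Field F] {G : Type} {A : Type*} [Ring A] [Algebra F A]

/-- The support of a grading: the degrees whose component is nonzero. -/
def gradedSupport (𝒜 : G → Submodule F A) : Set G := {g | 𝒜 g ≠ ⊥}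

/-- The grading has full support: every degree has a nonzero component. -/
def HasFullSupport (𝒜 : G → Submodule F A) : Prop := gradedSupport 𝒜 = Set.univ

variable (F G) in
/-- The free `G`-graded algebra `F⟨X|G⟩`. The free generator `(g, i)` is the variable of degree `g`
with lower index `i`, so there are countably many variables of each degree. -/
abbrev FreeGraded : Type u := FreeAlgebra F (G × ℕ)

/-- `T_G(A)`: the polynomials of `F⟨X|G⟩` that vanish under each admissible substitution. -/
def gradedIdentities (𝒜 : G → Submodule F A) : Set (FreeGraded F G) :=
  {f | ∀ s : G × ℕ → A, (∀ x, s x ∈ 𝒜 x.1) → FreeAlgebra.lift F s f = 0}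

/-- The graded algebra `A` belongs to the variety defined by the polynomials in `S`. -/
def InVariety [AddMonoid G] [DecidableEq G] (S : Set (FreeGraded F G))
    (𝒜 : G → Submodule F A) [GradedAlgebra 𝒜] : Prop :=
  S ⊆ gradedIdentities 𝒜

/-- The graded identities of the variety of `G`-graded algebras defined by `S`: the polynomials
that are graded identities of each algebra in that variety. -/
def varietyIdentities [AddMonoid G] [DecidableEq G] (S : Set (FreeGraded F G)) :
    Set (FreeGraded F G) :=
  {f | ∀ (C : Type u) [Ring C] [Algebra F C] (𝒞 : G → Submodule F C) [GradedAlgebra 𝒞],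
    InVariety S 𝒞 → f ∈ gradedIdentities 𝒞}

/-- The graded algebra `A` generates the variety of `G`-graded algebras defined by `S`: it belongs
to the variety and has the same graded identities. -/
def GeneratesVariety [AddMonoid G] [DecidableEq G] (𝒜 : G → Submodule F A) [GradedAlgebra 𝒜]
    (S : Set (FreeGraded F G)) : Prop :=
  InVariety S 𝒜 ∧ varietyIdentities S = gradedIdentities 𝒜

end Graded

/-! ## Reduction of degrees modulo `2` -/

/-- A renaming of the variables that replaces degrees in `ℤ` by their classes modulo `2`:
each variable of degree `g` goes to a variable of degree `g` modulo `2`, and different variables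
go to different variables. -/
def IsReduction (τ : ℤ × ℕ → ZMod 2 × ℕ) : Prop :=
  Function.Injective τ ∧ ∀ x, (τ x).1 = (x.1 : ZMod 2)

/-- The homomorphism `π₂ : F⟨X|ℤ⟩ → F⟨X|ℤ₂⟩` given by a renaming of the variables. -/
def piTwo (F : Type u) [Field F] (τ : ℤ × ℕ → ZMod 2 × ℕ) :
    FreeGraded F ℤ →ₐ[F] FreeGraded F (ZMod 2) :=
  FreeAlgebra.lift F (fun x => FreeAlgebra.ι F (τ x))

/-! ## The Grassmann algebra and its homogeneous gradings -/

/-- The Grassmann algebra `E` of the vector space with basis indexed by `ℕ`. -/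
abbrev Grassmann (F : Type u) [Field F] : Type u := ExteriorAlgebra F (ℕ →₀ F)

/-- The generators of `E`; `gen F i` is the `(i+1)`-st generator `e_{i+1}`. -/
def gen (F : Type u) [Field F] (i : ℕ) : Grassmann F :=
  ExteriorAlgebra.ι F (Finsupp.single i 1)

/-- The component of degree `g` of the grading of `E` in which the `i`-th generator has degree
`deg i`: the span of the monomials `e_{i₁} ⋯ e_{iₛ}` with `deg i₁ + ⋯ + deg iₛ = g`. -/
def component (F : Type u) [Field F] {G : Type} [AddCommMonoid G] (deg : ℕ → G) (g : G) :
    Submodule F (Grassmann F) :=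
  Submodule.span F {x | ∃ l : List ℕ, (l.map deg).sum = g ∧ x = (l.map (gen F)).prod}

section Grading

variable (F : Type u) [Field F] {G : Type} [AddCommMonoid G]

theorem gen_mem (deg : ℕ → G) (i : ℕ) : gen F i ∈ component F deg (deg i) :=
  Submodule.subset_span ⟨[i], by simp, by simp⟩

instance component_gradedMonoid (deg : ℕ → G) : SetLike.GradedMonoid (component F deg) where
  one_mem := Submodule.subset_span ⟨[], by simp, by simp⟩
  mul_mem := by
    intro g h x y hx hy
    have := Submodule.mul_mem_mul hx hy
    rw [component, component, Submodule.span_mul_span] at this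
    refine Submodule.span_mono ?_ this
    rintro _ ⟨x, ⟨l, hl, rfl⟩, y, ⟨m, hm, rfl⟩, rfl⟩
    exact ⟨l ++ m, by simp [hl, hm], by simp⟩

theorem gen_mul_gen (i j : ℕ) : gen F i * gen F j + gen F j * gen F i = 0 :=
  ExteriorAlgebra.ι_add_mul_swap _ _

theorem gen_mul_self (i : ℕ) : gen F i * gen F i = 0 :=
  ExteriorAlgebra.ι_sq_zero _

variable [DecidableEq G]

/-- The `i`-th generator as an element of its component. -/
abbrev genC (deg : ℕ → G) (i : ℕ) : component F deg (deg i) := ⟨gen F i, gen_mem F deg i⟩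

/-- The linear map that sends each generator to itself, placed in its component. -/
def toSumAux (deg : ℕ → G) : (ℕ →₀ F) →ₗ[F] ⨁ g, component F deg g :=
  Finsupp.linearCombination F
    (fun i => DirectSum.of (fun g => component F deg g) (deg i) (genC F deg i))

theorem toSumAux_single (deg : ℕ → G) (i : ℕ) (c : F) :
    toSumAux F deg (Finsupp.single i c) =
      c • DirectSum.of (fun g => component F deg g) (deg i) (genC F deg i) := by
  simp [toSumAux]

theorem toSumAux_anticomm (deg : ℕ → G) (m n : ℕ →₀ F) :
    toSumAux F deg m * toSumAux F deg n + toSumAux F deg n * toSumAux F deg m = 0 := by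
  induction m using Finsupp.induction_linear with
  | zero => simp
  | add m m' h h' =>
    rw [map_add, add_mul, mul_add, add_add_add_comm, h, h', add_zero]
  | single i c =>
    induction n using Finsupp.induction_linear with
    | zero => simp
    | add m m' h h' =>
      rw [map_add, add_mul, mul_add, add_add_add_comm, h, h', add_zero]
    | single j d =>
      rw [toSumAux_single, toSumAux_single, smul_mul_smul_comm, smul_mul_smul_comm, mul_comm d c,
        ← smul_add, DirectSum.of_mul_of, DirectSum.of_mul_of]
      have : DirectSum.of (fun g => component F deg g) (deg j + deg i)
          (GradedMonoid.GMul.mul (A := fun g => component F deg g) (genC F deg j) (genC F deg i)) =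
          - DirectSum.of (fun g => component F deg g) (deg i + deg j)
          (GradedMonoid.GMul.mul (A := fun g => component F deg g) (genC F deg i) (genC F deg j)) := by
        rw [← map_neg]
        apply DirectSum.of_eq_of_gradedMonoid_eq
        refine Sigma.subtype_ext (add_comm _ _) ?_
        exact eq_neg_of_add_eq_zero_left (gen_mul_gen F j i)
      rw [this, add_neg_cancel, smul_zero]

theorem toSumAux_sq (deg : ℕ → G) (m : ℕ →₀ F) :
    toSumAux F deg m * toSumAux F deg m = 0 := by
  induction m using Finsupp.induction_linear with
  | zero => simp
  | add m n h h' =>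
    rw [map_add, add_mul, mul_add, mul_add, h, h', zero_add, add_zero, toSumAux_anticomm]
  | single i c =>
    rw [toSumAux_single, smul_mul_smul_comm, DirectSum.of_mul_of]
    have : (GradedMonoid.GMul.mul (A := fun g => component F deg g)
        (genC F deg i) (genC F deg i)) = 0 := by
      apply Subtype.ext
      exact gen_mul_self F i
    rw [this, map_zero, smul_zero]

/-- The algebra homomorphism that splits an element of `E` into its components. -/
def toSum (deg : ℕ → G) : Grassmann F →ₐ[F] ⨁ g, component F deg g :=
  ExteriorAlgebra.lift F ⟨toSumAux F deg, toSumAux_sq F deg⟩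

theorem toSum_gen (deg : ℕ → G) (i : ℕ) : toSum F deg (gen F i) =
    DirectSum.of (fun g => component F deg g) (deg i) (genC F deg i) := by
  have := ExteriorAlgebra.lift_ι_apply F (toSumAux F deg) (toSumAux_sq F deg) (Finsupp.single i 1)
  rw [toSumAux_single, one_smul] at this
  exact this

theorem toSum_monomial (deg : ℕ → G) (l : List ℕ) :
    toSum F deg (l.map (gen F)).prod =
      DirectSum.of (fun g => component F deg g) (l.map deg).sum
        ⟨(l.map (gen F)).prod, Submodule.subset_span ⟨l, rfl, rfl⟩⟩ := by
  induction l with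
  | nil => simp only [List.map_nil, List.prod_nil, map_one]; rfl
  | cons i l ih =>
    have : toSum F deg ((i :: l).map (gen F)).prod =
        toSum F deg (gen F i) * toSum F deg (l.map (gen F)).prod := by
      rw [List.map_cons, List.prod_cons, map_mul]
    rw [this, ih, toSum_gen, DirectSum.of_mul_of]
    rfl

/-- The components of `E` form a grading of the algebra `E`. -/
instance component_gradedAlgebra (deg : ℕ → G) : GradedAlgebra (component F deg) :=
  GradedAlgebra.ofAlgHom _ (toSum F deg)
    (by
      ext i
      change DirectSum.coeAlgHom (component F deg) (toSum F deg (gen F i)) = gen F i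
      rw [toSum_gen, DirectSum.coeAlgHom_of])
    (by
      rintro g ⟨x, hx⟩
      change toSum F deg x = _
      induction hx using Submodule.span_induction with
      | mem x hx =>
        obtain ⟨l, rfl, rfl⟩ := hx
        exact toSum_monomial F deg l
      | zero => rw [map_zero]; exact (map_zero _).symm
      | add x y hx hy h h' => rw [map_add, h, h', ← map_add]; rfl
      | smul c x hx h =>
        rw [map_smul, h]
        exact (map_smul (DirectSum.lof F G (fun g => component F deg g) g) c ⟨x, hx⟩).symm)

end Grading

/-- The degrees `deg` of the generators come from a decomposition of the basis into `n` parts, the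
`j`-th of which consists of `v j` generators of degree `r j`. The corresponding grading of `E` is
the `n`-induced grading with lower indices `r` and upper indices `v`. -/
def IsInduced {G : Type} {n : ℕ} (r : Fin n → G) (v : Fin n → ℕ∞) (deg : ℕ → G) : Prop :=
  Function.Injective r ∧ (∀ i, ∃ j, deg i = r j) ∧ ∀ j, {i | deg i = r j}.encard = v j

/-- Degrees of the generators in the `ℤ₂`-grading `E_k`: the first `k` generators have degree `0`,
the others have degree `1`. -/
def degK (k : ℕ) (i : ℕ) : ZMod 2 := if i < k then 0 else 1

/-- Degrees of the generators in the `ℤ₂`-grading `E_∞`: `e_m` has degree `0` for even `m` and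
degree `1` for odd `m`, where `e_m` is `gen F (m - 1)`. -/
def degInf (i : ℕ) : ZMod 2 := if Even (i + 1) then 0 else 1

/-- The polynomials `f` in `F⟨X|ℤ⟩` with `π₂(f)` in the set `I`. -/
def pullback {F : Type u} [Field F] (τ : ℤ × ℕ → ZMod 2 × ℕ) (I : Set (FreeGraded F (ZMod 2))) :
    Set (FreeGraded F ℤ) :=
  {f | piTwo F τ f ∈ I}

end GrassmannGraded

end

/-!
A monomial of even length is central in `E`. If `w₁, …, w_N` are even monomials of degree `h` in
pairwise distinct generators, then `c = w₁ + ⋯ + w_N` is central of degree `h` with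
`c ^ (N + 1) = 0`, while `c ^ N = N! w₁ ⋯ w_N` annihilates nothing built from the other generators.
Hence a polynomial in `c` with coefficients in `E` that vanishes for all such `c` has zero
coefficients, and `c` may be specialized to `1`. Coprimality of `a` and `b` supplies even monomials
of degrees `2` and `-2`, so specialization moves the degrees by arbitrary even amounts and the
`ℤ`-graded identities only see the degrees modulo `2`. Up to renaming the generators, the grading
modulo `2` is that of `E_k` or `E_∞` according to the parity of `a * b`.
-/

namespace GrassmannGraded

/-! ## Exterior algebras -/

section Exterior

variable {R M X : Type*} [CommRing R] [AddCommGroup M] [Module R M]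

theorem contractLeft_eq_zero_of_mem_adjoin {d : Module.Dual R M} {p : ExteriorAlgebra R M}
    (hp : p ∈ Algebra.adjoin R (ExteriorAlgebra.ι R '' {m | d m = 0})) :
    CliffordAlgebra.contractLeft d p = 0 := by
  rw [← Subalgebra.mem_toSubmodule, Algebra.adjoin_eq_span] at hp
  induction hp using Submodule.span_induction with
  | mem x hx =>
    induction hx using Submonoid.closure_induction_left with
    | one => exact CliffordAlgebra.contractLeft_one _ _
    | mul_left x hx y _ ih =>
      obtain ⟨m, hm : d m = 0, rfl⟩ := hx
      refine (CliffordAlgebra.contractLeft_ι_mul d m y).trans ?_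
      rw [ih, hm, zero_smul, mul_zero, sub_zero]
  | zero => exact map_zero _
  | add x y _ _ hx hy => rw [map_add, hx, hy, add_zero]
  | smul c x _ hx => rw [map_smul, hx, smul_zero]

theorem eq_zero_of_ι_mul_eq_zero {d : Module.Dual R M} {m : M} (hm : d m = 1)
    {p : ExteriorAlgebra R M}
    (hp : p ∈ Algebra.adjoin R (ExteriorAlgebra.ι R '' {m | d m = 0}))
    (h : ExteriorAlgebra.ι R m * p = 0) : p = 0 := by
  have hcontract : CliffordAlgebra.contractLeft d (ExteriorAlgebra.ι R m * p) = p := by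
    refine (CliffordAlgebra.contractLeft_ι_mul d m p).trans ?_
    rw [contractLeft_eq_zero_of_mem_adjoin hp, hm, one_smul, mul_zero, sub_zero]
  rw [← hcontract, h, map_zero]

theorem ι_mul_ι_mem_center (u v : M) :
    ExteriorAlgebra.ι R u * ExteriorAlgebra.ι R v ∈
      Subalgebra.center R (ExteriorAlgebra R M) := by
  have anticomm (m n : M) : ExteriorAlgebra.ι R m * ExteriorAlgebra.ι R n =
      -(ExteriorAlgebra.ι R n * ExteriorAlgebra.ι R m) :=
    eq_neg_of_add_eq_zero_left (ExteriorAlgebra.ι_add_mul_swap m n)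
  refine Subalgebra.mem_center_iff.2 fun x => ?_
  change Commute x _
  induction x using ExteriorAlgebra.induction with
  | algebraMap r => exact Algebra.commutes r _
  | ι m =>
    rw [commute_iff_eq, ← mul_assoc, anticomm m u, neg_mul, mul_assoc, anticomm m v, mul_neg,
      neg_neg, mul_assoc]
  | mul x y hx hy => exact hx.mul_left hy
  | add x y hx hy => exact hx.add_left hy

theorem prod_map_ι_mem_center (v : X → M) : ∀ {l : List X}, Even l.length →
    (l.map fun i => ExteriorAlgebra.ι R (v i)).prod ∈ Subalgebra.center R (ExteriorAlgebra R M)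
  | [], _ => one_mem _
  | [_], h => absurd h Nat.not_even_one
  | i :: j :: l, h => by
    rw [List.map_cons, List.map_cons, List.prod_cons, List.prod_cons, ← mul_assoc]
    exact mul_mem (ι_mul_ι_mem_center _ _)
      (prod_map_ι_mem_center v (by simpa [Nat.even_add_one] using h))

theorem prod_map_ι_sq_eq_zero (v : X → M) {l : List X} (heven : Even l.length) (hne : l ≠ []) :
    (l.map fun i => ExteriorAlgebra.ι R (v i)).prod ^ 2 = 0 := by
  obtain ⟨i, l, rfl⟩ := List.exists_cons_of_ne_nil hne
  have hcomm := Subalgebra.mem_center_iff.1 (prod_map_ι_mem_center (R := R) v heven)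
    (ExteriorAlgebra.ι R (v i))
  rw [List.map_cons, List.prod_cons] at hcomm ⊢
  rw [sq, ← mul_assoc, ← hcomm, ← mul_assoc, ExteriorAlgebra.ι_sq_zero, zero_mul, zero_mul]

end Exterior

/-! ## Subalgebras generated by generators -/

section GenAlgebra

variable {F : Type u} [Field F]

/-- The subalgebra of `E` generated by the `gen F i` with `i ∈ S`. It makes precise that an element
of `E` involves only generators with index in `S`. -/
noncomputable def genAlgebra (F : Type u) [Field F] (S : Set ℕ) : Subalgebra F (Grassmann F) :=
  Algebra.adjoin F (gen F '' S)

theorem genAlgebra_mono {S T : Set ℕ} (h : S ⊆ T) : genAlgebra F S ≤ genAlgebra F T :=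
  Algebra.adjoin_mono (Set.image_mono h)

theorem gen_mem_genAlgebra {S : Set ℕ} {i : ℕ} (hi : i ∈ S) : gen F i ∈ genAlgebra F S :=
  Algebra.subset_adjoin (Set.mem_image_of_mem _ hi)

theorem prod_gen_mem_genAlgebra {S : Set ℕ} {l : List ℕ} (hl : ∀ i ∈ l, i ∈ S) :
    (l.map (gen F)).prod ∈ genAlgebra F S :=
  list_prod_mem <| List.forall_mem_map.2 fun i hi => gen_mem_genAlgebra (hl i hi)

theorem exists_mem_genAlgebra_Iio (x : Grassmann F) : ∃ M, x ∈ genAlgebra F (Set.Iio M) := by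
  have hdir : Directed (· ≤ ·) fun M => genAlgebra F (Set.Iio M) :=
    Monotone.directed_le fun _ _ h => genAlgebra_mono (Set.Iio_subset_Iio h)
  suffices htop : ⨆ M, genAlgebra F (Set.Iio M) = ⊤ by
    have hx : x ∈ (⨆ M, genAlgebra F (Set.Iio M) : Subalgebra F (Grassmann F)) := by simp [htop]
    simpa [← SetLike.mem_coe, Subalgebra.coe_iSup_of_directed hdir] using hx
  rw [eq_top_iff, ← CliffordAlgebra.adjoin_range_ι, Algebra.adjoin_le_iff]
  rintro _ ⟨m, rfl⟩
  induction m using Finsupp.induction_linear with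
  | zero => rw [map_zero]; exact zero_mem _
  | add m n hm hn => rw [map_add]; exact add_mem hm hn
  | single i c =>
    rw [← Finsupp.smul_single_one, map_smul]
    exact Subalgebra.smul_mem _ (le_iSup (fun M => genAlgebra F (Set.Iio M)) (i + 1)
      (gen_mem_genAlgebra i.lt_succ_self)) c

theorem eq_zero_of_gen_mul_eq_zero {S : Set ℕ} {i : ℕ} (hi : i ∉ S) {p : Grassmann F}
    (hp : p ∈ genAlgebra F S) (h : gen F i * p = 0) : p = 0 := by
  refine eq_zero_of_ι_mul_eq_zero (d := Finsupp.lapply i) (m := Finsupp.single i 1) (by simp)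
    (Algebra.adjoin_mono ?_ hp) h
  rintro _ ⟨j, hj, rfl⟩
  have hij : i ≠ j := (ne_of_mem_of_not_mem hj hi).symm
  exact ⟨_, Finsupp.single_eq_of_ne hij, rfl⟩

theorem eq_zero_of_prod_gen_mul_eq_zero {S : Set ℕ} {l : List ℕ} (hl : l.Nodup)
    (hlS : ∀ i ∈ l, i ∉ S) {p : Grassmann F} (hp : p ∈ genAlgebra F S)
    (h : (l.map (gen F)).prod * p = 0) : p = 0 := by
  induction l with
  | nil => simpa using h
  | cons i l ih =>
    rw [List.nodup_cons] at hl
    rw [List.forall_mem_cons] at hlS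
    rw [List.map_cons, List.prod_cons, mul_assoc] at h
    have hi : i ∉ {j | j ∈ l} ∪ S := not_or.2 ⟨hl.1, hlS.1⟩
    have hmem : (l.map (gen F)).prod * p ∈ genAlgebra F ({j | j ∈ l} ∪ S) :=
      mul_mem (prod_gen_mem_genAlgebra fun _ => Or.inl)
        (genAlgebra_mono Set.subset_union_right hp)
    exact ih hl.2 hlS.2 (eq_zero_of_gen_mul_eq_zero hi hmem h)

theorem prod_gen_ne_zero {l : List ℕ} (hl : l.Nodup) : (l.map (gen F)).prod ≠ 0 := fun h =>
  one_ne_zero (α := Grassmann F) <| eq_zero_of_prod_gen_mul_eq_zero hl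
    (fun _ _ => Set.notMem_empty _) (one_mem _) (by rw [h, zero_mul])

end GenAlgebra

/-! ## Degrees of late monomials -/

section LateMonomials

variable {G : Type} [AddCommMonoid G] {deg : ℕ → G}

/-- The pairs `(n, g)` such that arbitrarily late in the list of generators there are `n` distinct
ones whose degrees add up to `g`. The length `n` is recorded because the monomials of even length
are the central ones. -/
def lateMonomialDegrees (deg : ℕ → G) : AddSubmonoid (ℕ × G) where
  carrier := {p | ∀ M, ∃ l : List ℕ,
    l.Nodup ∧ (∀ i ∈ l, M ≤ i) ∧ l.length = p.1 ∧ (l.map deg).sum = p.2}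
  zero_mem' _ := ⟨[], by simp⟩
  add_mem' {p q} hp hq M := by
    obtain ⟨l, hl, hlM, hlen, hsum⟩ := hp M
    obtain ⟨N, hN⟩ := Finset.exists_nat_subset_range l.toFinset
    obtain ⟨l', hl', hlM', hlen', hsum'⟩ := hq (max M N)
    have hdisj : l.Disjoint l' := fun i hi hi' =>
      ((le_max_right M N).trans (hlM' i hi')).not_gt
        (Finset.mem_range.1 (hN (List.mem_toFinset.2 hi)))
    refine ⟨l ++ l', hl.append hl' hdisj, fun i hi => ?_, by simp [hlen, hlen'],
      by simp [hsum, hsum']⟩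
    exact (List.mem_append.1 hi).elim (hlM i) fun hi' => (le_max_left M N).trans (hlM' i hi')

theorem one_mk_mem_lateMonomialDegrees {g : G} (hg : {i | deg i = g}.Infinite) :
    (1, g) ∈ lateMonomialDegrees deg := fun M => by
  obtain ⟨i, hi, hMi⟩ := hg.exists_gt M
  exact ⟨[i], by simp, by simpa using hMi.le, by simp, by simpa using hi⟩

theorem exists_mk_mem_lateMonomialDegrees
    (hdeg : AddSubmonoid.closure {g | {i | deg i = g}.Infinite} = ⊤) (g : G) :
    ∃ n, (n, g) ∈ lateMonomialDegrees deg := by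
  have hle : AddSubmonoid.closure {g | {i | deg i = g}.Infinite} ≤
      (lateMonomialDegrees deg).map (AddMonoidHom.snd ℕ G) :=
    AddSubmonoid.closure_le.2 fun g hg => ⟨(1, g), one_mk_mem_lateMonomialDegrees hg, rfl⟩
  obtain ⟨⟨n, _⟩, hn, rfl⟩ := hle (hdeg ▸ AddSubmonoid.mem_top g)
  exact ⟨n, hn⟩

theorem exists_two_mul_mk_mem_lateMonomialDegrees
    (hdeg : AddSubmonoid.closure {g | {i | deg i = g}.Infinite} = ⊤) {g : G} (hg : g ≠ 0) :
    ∃ n ≠ 0, (2 * n, 2 • g) ∈ lateMonomialDegrees deg := by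
  obtain ⟨n, hn⟩ := exists_mk_mem_lateMonomialDegrees hdeg g
  refine ⟨n, ?_, (lateMonomialDegrees deg).nsmul_mem hn 2⟩
  rintro rfl
  obtain ⟨l, -, -, hlen, hsum⟩ := hn 0
  exact hg (by simpa [List.length_eq_zero_iff.1 hlen] using hsum.symm)

theorem hasFullSupport_component (F : Type u) [Field F]
    (hdeg : AddSubmonoid.closure {g | {i | deg i = g}.Infinite} = ⊤) :
    HasFullSupport (component F deg) := by
  refine Set.eq_univ_of_forall fun g => (Submodule.ne_bot_iff _).2 ?_
  obtain ⟨n, hn⟩ := exists_mk_mem_lateMonomialDegrees hdeg g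
  obtain ⟨l, hl, -, -, hsum⟩ := hn 0
  exact ⟨_, Submodule.subset_span ⟨l, hsum, rfl⟩, prod_gen_ne_zero hl⟩

end LateMonomials

/-! ## Specialization of central elements -/

section Central

variable {F : Type u} [Field F] {G : Type} [AddCommMonoid G]

/-- The central elements of degree `h` of the graded algebra `E`: the range of the central variable
that is specialized to `1`. -/
noncomputable def centralComponent (F : Type u) [Field F] (deg : ℕ → G) (h : G) :
    Submodule F (Grassmann F) :=
  component F deg h ⊓ Subalgebra.toSubmodule (Subalgebra.center F (Grassmann F))

theorem add_pow_succ_of_sq_eq_zero {R : Type*} [CommSemiring R] {c d : R} (hd : d ^ 2 = 0) (n : ℕ) :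
    (c + d) ^ (n + 1) = c ^ (n + 1) + (n + 1) * c ^ n * d := by
  simpa using Polynomial.eval_add_of_sq_eq_zero (Polynomial.X ^ (n + 1)) c d hd

theorem exists_central_pow_regular [CharZero F] {deg : ℕ → G} {h : G} {n : ℕ} (hn : n ≠ 0)
    (hlate : (2 * n, h) ∈ lateMonomialDegrees deg) (M N : ℕ) :
    ∃ c : Subalgebra.center F (Grassmann F), (c : Grassmann F) ∈ component F deg h ∧
      c ^ (N + 1) = 0 ∧
      ∀ p ∈ genAlgebra F (Set.Iio M), (c : Grassmann F) ^ N * p = 0 → p = 0 := by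
  induction N with
  | zero => exact ⟨0, zero_mem _, by simp, fun p _ => by simp⟩
  | succ N ih =>
    obtain ⟨c, hch, hc0, hcreg⟩ := ih
    obtain ⟨M', hM'⟩ := exists_mem_genAlgebra_Iio (c : Grassmann F)
    obtain ⟨l, hl, hlM, hlen, hsum⟩ := hlate (max M M')
    have heven : Even l.length := hlen ▸ even_two_mul n
    have hne : l ≠ [] := by
      rintro rfl
      simp only [List.length_nil] at hlen
      lia
    let w : Subalgebra.center F (Grassmann F) :=
      ⟨(l.map (gen F)).prod, prod_map_ι_mem_center _ heven⟩
    have hw : w ^ 2 = 0 := Subtype.ext (prod_map_ι_sq_eq_zero _ heven hne)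
    have hpow : (c + w) ^ (N + 1) = ((N + 1 : ℕ) : F) • (w * c ^ N) := by
      rw [add_pow_succ_of_sq_eq_zero hw, hc0, zero_add, Nat.cast_smul_eq_nsmul, nsmul_eq_mul,
        Nat.cast_succ, mul_assoc, mul_comm w]
    refine ⟨c + w, add_mem hch (Submodule.subset_span ⟨l, hsum, rfl⟩), ?_, fun p hp hzero => ?_⟩
    · rw [add_pow_succ_of_sq_eq_zero hw, pow_succ, hc0, zero_mul, mul_zero, zero_mul, add_zero]
    · have hwcp : (w : Grassmann F) * ((c : Grassmann F) ^ N * p) = 0 := by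
        rw [← SubmonoidClass.coe_pow, hpow] at hzero
        simpa [mul_assoc, Nat.cast_add_one_ne_zero] using hzero
      have hcp : (c : Grassmann F) ^ N * p ∈ genAlgebra F (Set.Iio (max M M')) :=
        mul_mem (pow_mem (genAlgebra_mono (Set.Iio_subset_Iio (le_max_right _ _)) hM') N)
          (genAlgebra_mono (Set.Iio_subset_Iio (le_max_left _ _)) hp)
      exact hcreg p hp
        (eq_zero_of_prod_gen_mul_eq_zero hl (fun i hi => not_lt.2 (hlM i hi)) hcp hwcp)

open Polynomial in
theorem eq_zero_of_forall_eval_centralComponent [CharZero F] {deg : ℕ → G} {h : G} {n : ℕ}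
    (hn : n ≠ 0) (hlate : (2 * n, h) ∈ lateMonomialDegrees deg) {P : (Grassmann F)[X]}
    (hP : ∀ c ∈ centralComponent F deg h, P.eval c = 0) : P = 0 := by
  ext N
  rw [coeff_zero]
  induction N using Nat.strong_induction_on with
  | _ N ih =>
    obtain ⟨M, hM⟩ := exists_mem_genAlgebra_Iio (P.coeff N)
    obtain ⟨c, hch, hc0, hcreg⟩ := exists_central_pow_regular (F := F) hn hlate M N
    have hterm (m : ℕ) (hm : m ≠ N) : P.coeff m * (c : Grassmann F) ^ m = 0 := by
      rcases hm.lt_or_gt with hlt | hgt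
      · rw [ih m hlt, zero_mul]
      · rw [← SubmonoidClass.coe_pow, pow_eq_zero_of_le hgt hc0, ZeroMemClass.coe_zero, mul_zero]
    have heval : P.eval (c : Grassmann F) = P.coeff N * (c : Grassmann F) ^ N := by
      rw [eval_eq_sum, sum_def]
      refine Finset.sum_eq_single N (fun m _ => hterm m) fun hN => ?_
      rw [notMem_support_iff.1 hN, zero_mul]
    refine hcreg _ hM ?_
    rw [← SubmonoidClass.coe_pow, ← Subalgebra.mem_center_iff.1 (c ^ N).2,
      SubmonoidClass.coe_pow, ← heval, hP _ ⟨hch, c.2⟩]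

end Central

section Specialization

open Polynomial

variable {R A B : Type*} [CommSemiring R] [Semiring A] [Algebra R A] [Semiring B] [Algebra R B]

theorem algHom_freeAlgebraLift {X : Type*} (φ : A →ₐ[R] B) (s : X → A) (f : FreeAlgebra R X) :
    φ (FreeAlgebra.lift R s f) = FreeAlgebra.lift R (φ ∘ s) f := by
  have hcomp : φ.comp (FreeAlgebra.lift R s) = FreeAlgebra.lift R (φ ∘ s) := by
    ext x
    simp
  exact DFunLike.congr_fun hcomp f

theorem eval_freeAlgebraLift {X : Type*} {c : A} (hc : c ∈ Subalgebra.center R A)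
    (q : X → A[X]) (f : FreeAlgebra R X) :
    (FreeAlgebra.lift R q f).eval c = FreeAlgebra.lift R (fun x => (q x).eval c) f :=
  algHom_freeAlgebraLift (eval₂AlgHom (AlgHom.id R A) c (Subalgebra.mem_center_iff.1 hc)) q f

/-- The values at `1` of the polynomials over `A` that take values in `W` at all elements of `C`.
If such polynomials are determined by their values on a set `C` of central elements, then the
identities satisfied on `W` persist on this larger submodule. -/
def specialization (C W : Submodule R A) : Submodule R A where
  carrier := {v | ∃ q : A[X], q.eval 1 = v ∧ ∀ c ∈ C, q.eval c ∈ W}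
  zero_mem' := ⟨0, by simp⟩
  add_mem' := by
    rintro _ _ ⟨q, rfl, hq⟩ ⟨r, rfl, hr⟩
    exact ⟨q + r, by simp, fun c hc => by simpa using add_mem (hq c hc) (hr c hc)⟩
  smul_mem' := by
    rintro t _ ⟨q, rfl, hq⟩
    exact ⟨t • q, by simp, fun c hc => by simpa using W.smul_mem t (hq c hc)⟩

theorem mem_specialization_of_mul_pow_mem {C W : Submodule R A} {v : A} (n : ℕ)
    (hv : ∀ c ∈ C, v * c ^ n ∈ W) : v ∈ specialization C W :=
  ⟨monomial n v, by simp, fun c hc => by simpa using hv c hc⟩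

theorem le_specialization (C W : Submodule R A) : W ≤ specialization C W := fun v hv =>
  mem_specialization_of_mul_pow_mem 0 fun c _ => by simpa using hv

theorem specialization_mono {C V W : Submodule R A} (h : V ≤ W) :
    specialization C V ≤ specialization C W := by
  rintro _ ⟨q, rfl, hq⟩
  exact ⟨q, rfl, fun c hc => h (hq c hc)⟩

end Specialization

/-! ## Graded identities -/

section Identities

variable {F : Type u} [Field F] {G : Type} {A B : Type*} [Ring A] [Algebra F A] [Ring B]
  [Algebra F B]

theorem gradedIdentities_subset_of_injective {𝒜 : G → Submodule F A} {ℬ : G → Submodule F B}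
    (φ : A →ₐ[F] B) (hφ : Function.Injective φ) (hdeg : ∀ g, ∀ x ∈ 𝒜 g, φ x ∈ ℬ g) :
    gradedIdentities ℬ ⊆ gradedIdentities 𝒜 := fun f hf s hs => hφ <| by
  rw [algHom_freeAlgebraLift, map_zero]
  exact hf _ fun x => hdeg x.1 _ (hs x)

theorem gradedIdentities_anti {𝒜 ℬ : G → Submodule F A} (h : ∀ g, 𝒜 g ≤ ℬ g) :
    gradedIdentities ℬ ⊆ gradedIdentities 𝒜 :=
  gradedIdentities_subset_of_injective (AlgHom.id F A) Function.injective_id fun g _ hx => h g hx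

open Polynomial in
theorem gradedIdentities_subset_specialization {C : Submodule F A}
    (hcenter : C ≤ Subalgebra.toSubmodule (Subalgebra.center F A))
    (hzero : ∀ P : A[X], (∀ c ∈ C, P.eval c = 0) → P = 0) (𝒜 : G → Submodule F A) :
    gradedIdentities 𝒜 ⊆ gradedIdentities fun g => specialization C (𝒜 g) := by
  intro f hf s hs
  choose q hq1 hqC using hs
  have hlift : FreeAlgebra.lift F q f = 0 := hzero _ fun c hc => by
    rw [eval_freeAlgebraLift (hcenter hc)]
    exact hf _ fun x => hqC x c hc
  calc FreeAlgebra.lift F s f = (FreeAlgebra.lift F q f).eval 1 := by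
        rw [eval_freeAlgebraLift (one_mem _)]
        simp only [hq1]
    _ = 0 := by rw [hlift, eval_zero]

theorem pullback_gradedIdentities {τ : ℤ × ℕ → ZMod 2 × ℕ} (hτ : IsReduction τ)
    (𝒜 : ZMod 2 → Submodule F A) :
    pullback τ (gradedIdentities 𝒜) = gradedIdentities fun g : ℤ => 𝒜 (g : ZMod 2) := by
  obtain ⟨hinj, hmod⟩ := hτ
  have hlift (t : ZMod 2 × ℕ → A) (f : FreeGraded F ℤ) :
      FreeAlgebra.lift F t (piTwo F τ f) = FreeAlgebra.lift F (t ∘ τ) f := by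
    rw [piTwo, algHom_freeAlgebraLift]
    congr 2
    ext x
    simp
  ext f
  constructor
  · intro hf s hs
    have hext : Function.extend τ s 0 ∘ τ = s := Function.extend_comp hinj s 0
    rw [← hext, ← hlift]
    refine hf _ fun y => ?_
    by_cases hy : ∃ x, τ x = y
    · obtain ⟨x, rfl⟩ := hy
      rw [hinj.extend_apply, hmod]
      exact hs x
    · rw [Function.extend_apply' _ _ _ hy]
      exact zero_mem _
  · intro hf t ht
    rw [hlift]
    exact hf _ fun x => by simpa only [Function.comp_apply, hmod] using ht (τ x)

theorem generatesVariety_gradedIdentities {A : Type u} [Ring A] [Algebra F A] [AddMonoid G]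
    [DecidableEq G] (𝒜 : G → Submodule F A) [GradedAlgebra 𝒜] :
    GeneratesVariety 𝒜 (gradedIdentities 𝒜) :=
  ⟨subset_rfl, Set.Subset.antisymm (fun _ hf => hf A 𝒜 subset_rfl)
    fun _ hf _ _ _ _ _ hvar => hvar hf⟩

end Identities

/-! ## Reduction of the grading of `E` modulo `2` -/

section Coarsening

variable {F : Type u} [Field F]

theorem component_comp_addMonoidHom {G H : Type} [AddCommMonoid G] [AddCommMonoid H]
    (π : G →+ H) (deg : ℕ → G) (h : H) :
    component F (π ∘ deg) h = ⨆ g : {g // π g = h}, component F deg g := by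
  have hsum (l : List ℕ) : (l.map (π ∘ deg)).sum = π (l.map deg).sum := by
    rw [map_list_sum, List.map_map]
  refine le_antisymm (Submodule.span_le.2 ?_) (iSup_le fun g => Submodule.span_mono ?_)
  · rintro _ ⟨l, rfl, rfl⟩
    exact Submodule.mem_iSup_of_mem ⟨(l.map deg).sum, (hsum l).symm⟩
      (Submodule.subset_span ⟨l, rfl, rfl⟩)
  · rintro _ ⟨l, hl, rfl⟩
    exact ⟨l, by rw [hsum, hl, g.2], rfl⟩

theorem component_le_specialization {G : Type} [AddCommMonoid G] {deg : ℕ → G} {g g' h : G}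
    {n : ℕ} (hg : g + n • h = g') :
    component F deg g ≤ specialization (centralComponent F deg h) (component F deg g') :=
  fun _ hv => mem_specialization_of_mul_pow_mem n fun _ hc =>
    hg ▸ SetLike.mul_mem_graded hv (SetLike.pow_mem_graded n hc.1)

theorem component_add_two_mul_le_specialization (deg : ℕ → ℤ) (g m : ℤ) :
    component F deg (g + 2 * m) ≤ specialization (centralComponent F deg (2 • (-1)))
      (specialization (centralComponent F deg (2 • 1)) (component F deg g)) := by
  obtain ⟨n, rfl | rfl⟩ := m.eq_nat_or_neg
  · exact (component_le_specialization (n := n) (by simp; ring)).trans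
      (specialization_mono (le_specialization _ _))
  · exact (component_le_specialization (n := n) (by simp; ring)).trans (le_specialization _ _)

theorem component_mod_two_le_specialization (deg : ℕ → ℤ) (g : ℤ) :
    component F (fun i => (deg i : ZMod 2)) (g : ZMod 2) ≤
      specialization (centralComponent F deg (2 • (-1)))
        (specialization (centralComponent F deg (2 • 1)) (component F deg g)) := by
  refine (component_comp_addMonoidHom (Int.castAddHom (ZMod 2)) deg g).trans_le (iSup_le ?_)
  rintro ⟨g', hg' : (g' : ZMod 2) = g⟩
  obtain ⟨m, hm⟩ := (ZMod.intCast_eq_intCast_iff_dvd_sub g g' 2).1 hg'.symm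
  obtain rfl : g' = g + 2 * m := by push_cast at hm; linarith
  exact component_add_two_mul_le_specialization deg g m

theorem gradedIdentities_component_eq_mod_two [CharZero F] {deg : ℕ → ℤ}
    (hdeg : AddSubmonoid.closure {g | {i | deg i = g}.Infinite} = ⊤) :
    gradedIdentities (component F deg) =
      gradedIdentities fun g : ℤ => component F (fun i => (deg i : ZMod 2)) (g : ZMod 2) := by
  have hspec (h : ℤ) (hh : h ≠ 0) (𝒜 : ℤ → Submodule F (Grassmann F)) : gradedIdentities 𝒜 ⊆
      gradedIdentities fun g => specialization (centralComponent F deg (2 • h)) (𝒜 g) := by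
    obtain ⟨n, hn, hlate⟩ := exists_two_mul_mk_mem_lateMonomialDegrees hdeg hh
    exact gradedIdentities_subset_specialization inf_le_right
      (fun P => eq_zero_of_forall_eval_centralComponent hn hlate) 𝒜
  apply Set.Subset.antisymm
  · calc gradedIdentities (component F deg)
        ⊆ _ := hspec 1 one_ne_zero _
      _ ⊆ _ := hspec (-1) (by decide) _
      _ ⊆ _ := gradedIdentities_anti (component_mod_two_le_specialization deg)
  · refine gradedIdentities_anti fun g => ?_
    exact (le_iSup (fun g' : {g' // Int.castAddHom (ZMod 2) g' = g} => component F deg g')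
      ⟨g, rfl⟩).trans_eq (component_comp_addMonoidHom (Int.castAddHom (ZMod 2)) deg g).symm

end Coarsening

/-! ## Renaming the generators -/

section Renaming

variable {F : Type u} [Field F] {G : Type} [AddCommMonoid G] {d d' : ℕ → G}

theorem gradedIdentities_component_subset_of_injective {σ : ℕ → ℕ} (hσ : Function.Injective σ)
    (hdeg : ∀ i, d' (σ i) = d i) :
    gradedIdentities (component F d') ⊆ gradedIdentities (component F d) := by
  let φ : Grassmann F →ₐ[F] Grassmann F := ExteriorAlgebra.map (Finsupp.lmapDomain F F σ)
  have hφ : Function.Injective φ := ExteriorAlgebra.map_injective_field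
    (LinearMap.ker_eq_bot.2 (Finsupp.mapDomain_injective hσ))
  have hgen (i : ℕ) : φ (gen F i) = gen F (σ i) := by simp [φ, gen]
  refine gradedIdentities_subset_of_injective φ hφ fun g => ?_
  suffices component F d g ≤ (component F d' g).comap φ.toLinearMap from fun x hx => this hx
  refine Submodule.span_le.2 ?_
  rintro _ ⟨l, rfl, rfl⟩
  refine Submodule.subset_span ⟨l.map σ, ?_, ?_⟩
  · simp only [List.map_map, Function.comp_def, hdeg]
  · simp only [AlgHom.toLinearMap_apply, map_list_prod, List.map_map, Function.comp_def, hgen]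

theorem gradedIdentities_component_subset_of_encard_le
    (h : ∀ g, {i | d i = g}.encard ≤ {i | d' i = g}.encard) :
    gradedIdentities (component F d') ⊆ gradedIdentities (component F d) := by
  have hfiber (g : G) : Nonempty ({i // d i = g} ↪ {i // d' i = g}) :=
    (Cardinal.toENat_le_iff_of_le_aleph0 Cardinal.mk_le_aleph0).1 (h g)
  let e (g : G) := (hfiber g).some
  let σ : ℕ ↪ ℕ := (Equiv.sigmaFiberEquiv d).symm.toEmbedding.trans
    ((Function.Embedding.sigmaMap (.refl G) e).trans (Equiv.sigmaFiberEquiv d').toEmbedding)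
  exact gradedIdentities_component_subset_of_injective σ.injective
    fun i => (e (d i) ⟨i, rfl⟩).2

theorem gradedIdentities_component_eq_of_encard_eq
    (h : ∀ g, {i | d i = g}.encard = {i | d' i = g}.encard) :
    gradedIdentities (component F d) = gradedIdentities (component F d') :=
  Set.Subset.antisymm (gradedIdentities_component_subset_of_encard_le fun g => (h g).ge)
    (gradedIdentities_component_subset_of_encard_le fun g => (h g).le)

end Renaming

/-! ## The degrees `-b`, `0`, `a` -/

section Degrees

theorem closure_natCast_neg_natCast_eq_top {a b : ℕ} (ha : 0 < a) (hb : 0 < b)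
    (hab : Nat.gcd a b = 1) : AddSubmonoid.closure {(a : ℤ), -(b : ℤ)} = ⊤ := by
  refine (AddSubmonoid.eq_top_iff' _).2 fun g => (AddSubmonoid.mem_closure_pair _ _ _).2 ?_
  obtain ⟨x, y, hxy⟩ : ∃ x y : ℤ, a * x + b * y = g :=
    ⟨a.gcdA b * g, a.gcdB b * g, by
      rw [← mul_assoc, ← mul_assoc, ← add_mul, ← Nat.gcd_eq_gcd_ab, hab, Nat.cast_one, one_mul]⟩
  -- Adding a large multiple of `(b, -a)` to `(x, y)` makes `x` nonnegative and `y` nonpositive.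
  obtain ⟨m, hm⟩ := Int.eq_ofNat_of_zero_le (show 0 ≤ x + b * (|x| + |y|) by
    nlinarith [neg_abs_le x, abs_nonneg x, abs_nonneg y])
  obtain ⟨n, hn⟩ := Int.eq_ofNat_of_zero_le (show 0 ≤ -y + a * (|x| + |y|) by
    nlinarith [le_abs_self y, abs_nonneg x, abs_nonneg y])
  refine ⟨m, n, ?_⟩
  rw [nsmul_eq_mul, nsmul_eq_mul, ← hm, ← hn]
  linear_combination hxy

theorem encard_degK_zero (k : ℕ) : {i | degK k i = 0}.encard = k := by
  have hrange : {i | degK k i = 0} = (Finset.range k : Set ℕ) := by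
    ext i
    simp [degK]
  rw [hrange, Set.encard_coe_eq_coe_finsetCard, Finset.card_range]

theorem encard_degK_one (k : ℕ) : {i | degK k i = 1}.encard = ⊤ := by
  refine Set.encard_eq_top_iff.2 ((Set.Ici_infinite k).mono fun i hi => ?_)
  simpa [degK] using hi

theorem encard_degInf : ∀ g, {i | degInf i = g}.encard = ⊤ := by
  have hodd (n : ℕ) : degInf (2 * n + 1) = 0 := by simp [degInf, parity_simps]
  have heven (n : ℕ) : degInf (2 * n) = 1 := by simp [degInf, parity_simps]
  refine Fin.forall_fin_two.2 ⟨?_, ?_⟩ <;> refine Set.encard_eq_top_iff.2 ?_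
  · exact Set.infinite_of_injective_forall_mem (fun m n h => by simpa using h) hodd
  · exact Set.infinite_of_injective_forall_mem (fun m n h => by simpa using h) heven

variable {a b k : ℕ} {deg : ℕ → ℤ}

theorem closure_infinite_fibers_eq_top (ha : 0 < a) (hb : 0 < b) (hab : Nat.gcd a b = 1)
    (hdeg : IsInduced ![-(b : ℤ), 0, (a : ℤ)] ![⊤, (k : ℕ∞), ⊤] deg) :
    AddSubmonoid.closure {g | {i | deg i = g}.Infinite} = ⊤ := by
  rw [eq_top_iff, ← closure_natCast_neg_natCast_eq_top ha hb hab]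
  refine AddSubmonoid.closure_mono (Set.pair_subset ?_ ?_)
  exacts [Set.encard_eq_top_iff.1 (hdeg.2.2 2), Set.encard_eq_top_iff.1 (hdeg.2.2 0)]

theorem encard_mod_two_of_odd (hodd : Odd (a * b))
    (hdeg : IsInduced ![-(b : ℤ), 0, (a : ℤ)] ![⊤, (k : ℕ∞), ⊤] deg) :
    ∀ g, {i | (deg i : ZMod 2) = g}.encard = {i | degK k i = g}.encard := by
  obtain ⟨-, hmem, hcard⟩ := hdeg
  have ha : (a : ZMod 2) = 1 := ZMod.natCast_eq_one_iff_odd.2 (Nat.odd_mul.1 hodd).1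
  have hb : (b : ZMod 2) = 1 := ZMod.natCast_eq_one_iff_odd.2 (Nat.odd_mul.1 hodd).2
  have hzero : {i | (deg i : ZMod 2) = 0} = {i | deg i = 0} := by
    ext i
    refine ⟨fun hi : (deg i : ZMod 2) = 0 => ?_, fun hi : deg i = 0 => by simp [hi]⟩
    obtain ⟨j, hj⟩ := hmem i
    fin_cases j
    · simp [hj, hb] at hi
    · exact hj
    · simp [hj, ha] at hi
  have hone : {i | (deg i : ZMod 2) = 1}.Infinite :=
    (Set.encard_eq_top_iff.1 (hcard 2)).mono fun i (hi : deg i = a) => by simp [hi, ha]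
  refine Fin.forall_fin_two.2 ⟨?_, ?_⟩
  · exact (congrArg Set.encard hzero).trans ((hcard 1).trans (encard_degK_zero k).symm)
  · exact hone.encard_eq.trans (encard_degK_one k).symm

theorem encard_mod_two_of_even (hab : Nat.gcd a b = 1) (heven : Even (a * b))
    (hdeg : IsInduced ![-(b : ℤ), 0, (a : ℤ)] ![⊤, (k : ℕ∞), ⊤] deg) (g : ZMod 2) :
    {i | (deg i : ZMod 2) = g}.encard = {i | degInf i = g}.encard := by
  have hpar : (a : ZMod 2) = g ∨ (b : ZMod 2) = g := by
    have hne : (a : ZMod 2) ≠ b := fun h => by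
      have hiff : 2 ∣ a ↔ 2 ∣ b := by
        rw [← ZMod.natCast_eq_zero_iff, ← ZMod.natCast_eq_zero_iff, h]
      have hdvd : 2 ∣ a ∧ 2 ∣ b := by
        have := Nat.prime_two.dvd_mul.1 heven.two_dvd
        tauto
      exact absurd (hab ▸ Nat.dvd_gcd hdvd.1 hdvd.2) (by decide)
    revert hne
    generalize (a : ZMod 2) = x
    generalize (b : ZMod 2) = y
    revert x y g
    decide
  rw [encard_degInf, Set.encard_eq_top_iff]
  rcases hpar with ha | hb
  · exact (Set.encard_eq_top_iff.1 (hdeg.2.2 2)).mono fun i (hi : deg i = a) => by simp [hi, ha]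
  · exact (Set.encard_eq_top_iff.1 (hdeg.2.2 0)).mono fun i (hi : deg i = -b) => by simp [hi, hb]

end Degrees

end GrassmannGraded

open GrassmannGraded in
theorem mainTheorem4_general (F : Type u) [Field F] [CharZero F] {deg : ℕ → ℤ}
    (hdeg : AddSubmonoid.closure {g | {i | deg i = g}.Infinite} = ⊤) :
    HasFullSupport (component F deg) ∧
    ∀ τ : ℤ × ℕ → ZMod 2 × ℕ, IsReduction τ → ∀ d : ℕ → ZMod 2,
      (∀ g, {i | (deg i : ZMod 2) = g}.encard = {i | d i = g}.encard) →
        gradedIdentities (component F deg) = pullback τ (gradedIdentities (component F d)) ∧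
        GeneratesVariety (component F deg) (pullback τ (gradedIdentities (component F d))) := by
  refine ⟨hasFullSupport_component F hdeg, fun τ hτ d hd => ?_⟩
  have hid : gradedIdentities (component F deg) =
      pullback τ (gradedIdentities (component F d)) := by
    rw [← gradedIdentities_component_eq_of_encard_eq hd, pullback_gradedIdentities hτ,
      gradedIdentities_component_eq_mod_two hdeg]
  exact ⟨hid, hid ▸ generatesVariety_gradedIdentities (component F deg)⟩

theorem mainTheorem4 (F : Type u) [Field F] [CharZero F] (a b k : ℕ)
    (ha : 0 < a) (hb : 0 < b) (hk : 0 < k) (hab : Nat.gcd a b = 1)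
    (deg : ℕ → ℤ)
    (hdeg : GrassmannGraded.IsInduced ![-(b : ℤ), 0, (a : ℤ)] ![⊤, (k : ℕ∞), ⊤] deg) :
    GrassmannGraded.HasFullSupport (GrassmannGraded.component F deg) ∧
    ∀ τ : ℤ × ℕ → ZMod 2 × ℕ, GrassmannGraded.IsReduction τ →
      (Odd (a * b) →
        GrassmannGraded.gradedIdentities (GrassmannGraded.component F deg) =
          GrassmannGraded.pullback τ (GrassmannGraded.gradedIdentities
            (GrassmannGraded.component F (GrassmannGraded.degK k))) ∧
        GrassmannGraded.GeneratesVariety (GrassmannGraded.component F deg)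
          (GrassmannGraded.pullback τ (GrassmannGraded.gradedIdentities
            (GrassmannGraded.component F (GrassmannGraded.degK k))))) ∧
      (Even (a * b) →
        GrassmannGraded.gradedIdentities (GrassmannGraded.component F deg) =
          GrassmannGraded.pullback τ (GrassmannGraded.gradedIdentities
            (GrassmannGraded.component F GrassmannGraded.degInf)) ∧
        GrassmannGraded.GeneratesVariety (GrassmannGraded.component F deg)
          (GrassmannGraded.pullback τ (GrassmannGraded.gradedIdentities
            (GrassmannGraded.component F GrassmannGraded.degInf)))) :=
  have ⟨hsupport, hidentities⟩ := mainTheorem4_general F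
    (GrassmannGraded.closure_infinite_fibers_eq_top ha hb hab hdeg)
  ⟨hsupport, fun τ hτ =>
    ⟨fun hodd => hidentities τ hτ _ (GrassmannGraded.encard_mod_two_of_odd hodd hdeg),
      fun heven => hidentities τ hτ _ (GrassmannGraded.encard_mod_two_of_even hab heven hdeg)⟩⟩
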